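/- For $n\in\mathbb{N}=\{0,1,2,\dots\}$ let $t_n\in\mathbb{F}_5$ be the residue modulo $5$ of the sum of the base-$5$ digits of $n$, and let $F=\sum_{n\ge 0}t_nX^n\in\mathbb{F}_5[[X]]$. Since $t_0=0$ and $t_1=1$, there is a unique power series $C=\sum_{n\ge 0}d_nX^n\in\mathbb{F}_5[[X]]$ with zero constant term such that $C(F(X))=F(C(X))=X$. Its coefficients $(d_n)_{n\ge 0}$ have the following properties. 1. $d_{5n+3}=0$ for all $n\in\mathbb{N}$. 2. For each $i\in\{1,2,3,4\}$, the maximal number of consecutive terms of $(d_n)$ equal to $i$ is exactly $4$: there is some $n$ with $d_n=d_{n+1}=d_{n+2}=d_{n+3}=i$, and no block of more than $4$ consecutive terms consists only of $i$'s. 3. For each $i\in\{1,2,3,4\}$, the set $\mathcal{D}_i=\{n\in\mathbb{N}: d_n=d_{n+1}=d_{n+2}=d_{n+3}=i\}$ is infinite. Explicitly, $k^{(i)}_n\in\mathcal{D}_i$ for all $n\in\mathbb{N}$, where the $k^{(i)}_n$ are given by their base-$5$ expansions (most significant digit first) $$(k^{(1)}_n)_5=100\underbrace{2\cdots2}_{n+1}44,\quad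 (k^{(2)}_n)_5=31\underbrace{2\cdots2}_{n+1}44,\quad (k^{(3)}_n)_5=210\underbrace{2\cdots2}_{n+1}44,\quad (k^{(4)}_n)_5=3021\underbrace{2\cdots2}_{n+1}44.$$ -/

import Mathlib

/-- The generalized Thue--Morse sequence: the sum of the base-`p` digits of `n`, reduced
modulo `p`. -/
def thueMorse (p n : ℕ) : ZMod p := ((Nat.digits p n).sum : ZMod p)

/-- The generating series `F_p = ∑ t_n X^n` of the generalized Thue--Morse sequence. -/
noncomputable def thueMorseSeries (p : ℕ) : PowerSeries (ZMod p) :=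
  PowerSeries.mk (thueMorse p)

theorem constantCoeff_thueMorseSeries (p : ℕ) :
    PowerSeries.constantCoeff (thueMorseSeries p) = 0 := by
  simp [thueMorseSeries, thueMorse]

theorem isUnit_coeff_one_thueMorseSeries (p : ℕ) :
    IsUnit (PowerSeries.coeff 1 (thueMorseSeries p)) := by
  have h : (Nat.digits p 1).sum = 1 := by
    rcases p with _ | _ | p
    · simp
    · simp
    · rw [Nat.digits_of_lt _ 1 one_ne_zero (by omega)]
      simp
  simp [thueMorseSeries, thueMorse, h]

/-- The compositional inverse `C_p` of `F_p`. -/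
noncomputable def inverseSeries (p : ℕ) : PowerSeries (ZMod p) :=
  (thueMorseSeries p).substInvOfIsUnit (isUnit_coeff_one_thueMorseSeries p)

/-- `F_p(C_p(X)) = X` and `C_p(F_p(X)) = X` (`PowerSeries.subst g f` is `f(g(X))`). -/
theorem inverseSeries_spec (p : ℕ) :
    PowerSeries.constantCoeff (inverseSeries p) = 0 ∧
    PowerSeries.subst (inverseSeries p) (thueMorseSeries p) = PowerSeries.X ∧
    PowerSeries.subst (thueMorseSeries p) (inverseSeries p) = PowerSeries.X :=
  ⟨PowerSeries.constantCoeff_substInvOfIsUnit _ _,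
    PowerSeries.subst_substInvOfIsUnit_right _ (constantCoeff_thueMorseSeries p) _,
    PowerSeries.subst_substInvOfIsUnit_left _ (constantCoeff_thueMorseSeries p) _⟩

/-- The formal inverse `(c_n)` of the generalized Thue--Morse sequence: the coefficients
of `C_p`. -/
noncomputable def inverseThueMorse (p n : ℕ) : ZMod p :=
  PowerSeries.coeff n (inverseSeries p)

/-- The case `p = 5`. -/
noncomputable def d (n : ℕ) : ZMod 5 := inverseThueMorse 5 n

/-- The set of starting indices of four consecutive terms equal to `i`. -/
def fourRunStarts (i : ℕ) : Set ℕ :=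
  {n | d n = (i : ZMod 5) ∧ d (n + 1) = (i : ZMod 5) ∧
    d (n + 2) = (i : ZMod 5) ∧ d (n + 3) = (i : ZMod 5)}

/-- The leading base-5 digits (most significant first) of the explicit starting indices. -/
def leadingDigits : ℕ → List ℕ
  | 1 => [1, 0, 0]
  | 2 => [3, 1]
  | 3 => [2, 1, 0]
  | 4 => [3, 0, 2, 1]
  | _ => []

/-- The number whose base-5 expansion, most significant digit first, is the leading block of
`i`, followed by `n + 1` digits `2`, followed by `44`. (`Nat.ofDigits` reads the least
significant digit first.) -/
def explicitStart (i n : ℕ) : ℕ :=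
  Nat.ofDigits 5 (leadingDigits i ++ List.replicate (n + 1) 2 ++ [4, 4]).reverse

/-!
The recursion `t_{5n+r} = t_n + r` makes `F = F_5` algebraic over `𝔽_5(X)`:
`(1 - X)² F = (1 - X)⁶ F⁵ + X` (`thueMorseSeries_five_equation`). Substituting the inverse series `C`
and multiplying by `X` shows that `H = X (1 - C)` satisfies `H + H² - H⁶ = X`
(`shiftedInverse_equation`), so that `H` is the compositional inverse of the polynomial
`P = X + X² - X⁶`, and `d_n` is minus the coefficient of `H` at `n + 1` for `n ≥ 1`.

The coefficients of such an inverse are read off by a finite automaton whose states are polynomials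
`A`, each representing the series `A(H) H'`. Let `Λ` be the operator `∑ a_n X^n ↦ ∑ a_{5n+4} X^n`.
It satisfies `Λ(f⁵ g) = f Λ(g)`, it kills `f^j f'` for `j < 4`, and it maps `f⁴ f'` to `f'`
(`powerSeriesSection_pow_mul_derivative`, `powerSeriesSection_pow_pred_mul_derivative`). Hence
`Λ(A(H) H') = B(H) H'`, where `B` collects the coefficients of `A` of index `4` modulo `5`. The
`r`-th section of `A(H) H'` is `Λ(X^{4-r} A(H) H')` with `X = P(H)`, so it is again of this form; this
is the transition `digitStep`. The initial state is `A = X P'`, since `P'(H) H' = 1` gives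
`H = A(H) H'`.

Everything else is a computation with these polynomials. The digit `4` leads from the initial state
to `0`, so `d_{5n+3} = 0`, and no five consecutive terms are equal to the same nonzero value. The
numbers `k + 1, …, k + 4`, for `k` one of the explicit starting indices, end in the digits
`3, 0, j` with `j < 4`, preceded by digits `2` and by the leading block. Reading `j, 0, 3` from the
initial state leads to a polynomial of the form `(1 + c) + c X`; the digit `2` preserves this form,
replacing `c` by `3 c`; and the leading block belonging to `i` sends every polynomial of this form to
one with constant term `-i`.
-/

open PowerSeries

/-! ### Sections of power series -/

/-- The `r`-th section of a power series modulo `p`: `∑ a_n X^n ↦ ∑ a_{pn+r} X^n`. -/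
noncomputable def powerSeriesSection {R : Type*} [CommRing R] (p r : ℕ) : R⟦X⟧ →ₗ[R] R⟦X⟧ where
  toFun f := PowerSeries.mk fun n => coeff (p * n + r) f
  map_add' f g := by ext; simp
  map_smul' c f := by ext; simp

theorem coeff_powerSeriesSection {R : Type*} [CommRing R] (p r n : ℕ) (f : R⟦X⟧) :
    coeff n (powerSeriesSection p r f) = coeff (p * n + r) f := by
  simp [powerSeriesSection]

theorem powerSeriesSection_expand_mul {R : Type*} [CommRing R] {p r : ℕ} (hp : p ≠ 0) (hr : r < p)
    (f g : R⟦X⟧) :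
    powerSeriesSection p r (expand p hp f * g) = f * powerSeriesSection p r g := by
  ext n
  rw [coeff_powerSeriesSection, coeff_mul, coeff_mul]
  symm
  refine Finset.sum_of_injOn (fun x => (p * x.1, p * x.2 + r)) ?_ ?_ ?_ ?_
  · rintro ⟨a, b⟩ - ⟨a', b'⟩ - h
    simpa [hp] using h
  · rintro ⟨a, b⟩ h
    rw [Finset.mem_coe, Finset.HasAntidiagonal.mem_antidiagonal] at h ⊢
    dsimp only at h ⊢
    rw [← h]; ring
  · rintro ⟨a, b⟩ h h'
    rw [coeff_expand_of_not_dvd, zero_mul]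
    rintro ⟨k, rfl⟩
    rw [Finset.HasAntidiagonal.mem_antidiagonal] at h
    dsimp only at h
    -- `p * k ≤ p * n + r` with `r < p` leaves an index of the form `p * (n - k) + r`
    have hk : k ≤ n := by
      by_contra! hlt
      have := Nat.mul_le_mul_left p (Nat.succ_le_of_lt hlt)
      rw [Nat.mul_succ] at this
      omega
    refine h' ⟨(k, n - k), by simp [hk], ?_⟩
    obtain ⟨j, rfl⟩ := Nat.exists_eq_add_of_le hk
    rw [mul_add] at h
    simp
    omega
  · rintro ⟨a, b⟩ -
    simp [coeff_powerSeriesSection]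

theorem expand_eq_pow_of_zmod (p : ℕ) [hp : Fact p.Prime] (f : (ZMod p)⟦X⟧) :
    expand p hp.out.ne_zero f = f ^ p := by
  have h := MvPowerSeries.map_frobenius_expand p hp.out.ne_zero (f := f)
  rw [ZMod.frobenius_zmod] at h
  rw [← h, MvPowerSeries.map_id]
  rfl

theorem powerSeriesSection_pow_mul {p r : ℕ} [Fact p.Prime] (hr : r < p) (f g : (ZMod p)⟦X⟧) :
    powerSeriesSection p r (f ^ p * g) = f * powerSeriesSection p r g := by
  rw [← expand_eq_pow_of_zmod, powerSeriesSection_expand_mul _ hr]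

/-- The top section kills `f ^ j * f'` for `j + 1 < p`, which is the derivative of
`f ^ (j + 1) / (j + 1)`. -/
theorem powerSeriesSection_pow_mul_derivative {p j : ℕ} [Fact p.Prime] (hj : j + 1 < p)
    (f : (ZMod p)⟦X⟧) :
    powerSeriesSection p (p - 1) (f ^ j * derivative (ZMod p) f) = 0 := by
  ext n
  have h := congrArg (coeff (p * n + (p - 1))) (derivative_pow f (j + 1))
  have hp : p * n + (p - 1) + 1 = p * (n + 1) := by rw [mul_add]; omega
  have h0 : ((p * n + (p - 1) : ℕ) : ZMod p) + 1 = 0 := by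
    rw [← Nat.cast_succ, Nat.succ_eq_add_one, hp]; simp
  rw [coeff_derivative, h0, mul_zero, Nat.add_sub_cancel, mul_assoc,
    ← map_natCast (C (R := ZMod p)), coeff_C_mul] at h
  rw [coeff_powerSeriesSection, map_zero]
  refine (mul_eq_zero.1 h.symm).resolve_left fun h => ?_
  rw [ZMod.natCast_eq_zero_iff] at h
  exact absurd (Nat.le_of_dvd (by omega) h) (by omega)

/-- The top section (the Cartier operator) maps `f ^ (p - 1) * f'` to `f'`. Over `ℤ` the former is
the derivative of `f ^ p` divided by `p`, so the division is carried out on a lift of `f`. -/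
theorem powerSeriesSection_pow_pred_mul_derivative {p : ℕ} [hp : Fact p.Prime]
    (f : (ZMod p)⟦X⟧) :
    powerSeriesSection p (p - 1) (f ^ (p - 1) * derivative (ZMod p) f) =
      derivative (ZMod p) f := by
  obtain ⟨g, rfl⟩ : ∃ g : ℤ⟦X⟧, PowerSeries.map (Int.castRingHom (ZMod p)) g = f :=
    ⟨PowerSeries.mk fun n => ((coeff n f).val : ℤ), by ext; simp⟩
  have hder : derivative (ZMod p) (PowerSeries.map (Int.castRingHom (ZMod p)) g) =
      PowerSeries.map (Int.castRingHom (ZMod p)) (derivative ℤ g) := by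
    ext n; simp [coeff_derivative]
  ext n
  have hpos := hp.out.pos
  have hidx : p * n + (p - 1) + 1 = p * (n + 1) := by rw [mul_add]; omega
  have h0 : ((p * n + (p - 1) : ℕ) : ℤ) + 1 = p * ((n : ℤ) + 1) := by exact_mod_cast hidx
  have h := congrArg (coeff (p * n + (p - 1))) (derivative_pow g p)
  rw [coeff_derivative, h0, mul_assoc, ← map_natCast (C (R := ℤ)), coeff_C_mul,
    mul_left_comm, hidx] at h
  have h := congrArg (Int.castRingHom (ZMod p))
    (mul_left_cancel₀ (Nat.cast_ne_zero.2 hp.out.ne_zero) h)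
  rw [coeff_powerSeriesSection, hder, ← map_pow, ← map_mul, coeff_map, ← h, map_mul, ← coeff_map,
    map_pow, ← expand_eq_pow_of_zmod, coeff_expand_mul, ← hder, coeff_derivative]
  simp

/-! ### Polynomials as coefficient lists -/

/-- Sum of polynomials given by their lists of coefficients, constant term first. -/
def addList {R : Type*} [Add R] : List R → List R → List R
  | [], m => m
  | a :: l, [] => a :: l
  | a :: l, b :: m => (a + b) :: addList l m

/-- Product of polynomials given by their lists of coefficients, constant term first. -/
def mulList {R : Type*} [CommRing R] : List R → List R → List R
  | [], _ => []
  | a :: l, m => addList (m.map (a * ·)) (0 :: mulList l m)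

/-- Power of a polynomial given by its list of coefficients. -/
def powList {R : Type*} [CommRing R] (l : List R) : ℕ → List R
  | 0 => [1]
  | n + 1 => mulList l (powList l n)

/-- Every fifth entry of a list, starting with the entry of index `4`. On coefficient lists this is
the polynomial counterpart of `powerSeriesSection 5 4`. -/
def everyFifth {R : Type*} : List R → List R
  | _ :: _ :: _ :: _ :: e :: l => e :: everyFifth l
  | _ => []

/-- The value at a power series `H` of the polynomial with the given coefficients. -/
noncomputable def evalList {R : Type*} [CommRing R] (H : R⟦X⟧) : List R → R⟦X⟧
  | [] => 0
  | a :: l => C a + H * evalList H l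

section evalList

variable {R : Type*} [CommRing R] (H : R⟦X⟧)

theorem evalList_addList (l m : List R) :
    evalList H (addList l m) = evalList H l + evalList H m := by
  induction l generalizing m with
  | nil => simp [addList, evalList]
  | cons a l ih =>
    cases m with
    | nil => simp [addList, evalList]
    | cons b m => simp only [addList, evalList, ih, map_add]; ring

theorem evalList_map_mul (a : R) (l : List R) :
    evalList H (l.map (a * ·)) = C a * evalList H l := by
  induction l with
  | nil => simp [evalList]
  | cons b l ih => simp only [List.map_cons, evalList, ih, map_mul]; ring

theorem evalList_mulList (l m : List R) :
    evalList H (mulList l m) = evalList H l * evalList H m := by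
  induction l with
  | nil => simp [mulList, evalList]
  | cons a l ih =>
    simp only [mulList, evalList, evalList_addList, evalList_map_mul, ih, map_zero]; ring

theorem evalList_powList (l : List R) (n : ℕ) :
    evalList H (powList l n) = evalList H l ^ n := by
  induction n with
  | zero => simp [powList, evalList]
  | succ n ih => rw [powList, evalList_mulList, ih, pow_succ']

theorem constantCoeff_evalList (hH : constantCoeff H = 0) (l : List R) :
    constantCoeff (evalList H l) = l.headD 0 := by
  cases l <;> simp [evalList, hH]

end evalList

/-- The top section maps `A(H) * H'` to `B(H) * H'`, where `B` collects the coefficients of `A` of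
index `4` modulo `5`: this is the Cartier operator on polynomial differential forms, evaluated
at `H`. -/
theorem powerSeriesSection_evalList_mul_derivative (H : (ZMod 5)⟦X⟧) (l : List (ZMod 5)) :
    powerSeriesSection 5 4 (evalList H l * derivative (ZMod 5) H) =
      evalList H (everyFifth l) * derivative (ZMod 5) H := by
  have : Fact (Nat.Prime 5) := ⟨Nat.prime_five⟩
  have hC (a : ZMod 5) (f : (ZMod 5)⟦X⟧) :
      powerSeriesSection 5 4 (C a * f) = C a * powerSeriesSection 5 4 f := by
    rw [← smul_eq_C_mul, map_smul, smul_eq_C_mul]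
  have h0 := powerSeriesSection_pow_mul_derivative (p := 5) (j := 0) (by norm_num) H
  have h1 := powerSeriesSection_pow_mul_derivative (p := 5) (j := 1) (by norm_num) H
  have h2 := powerSeriesSection_pow_mul_derivative (p := 5) (j := 2) (by norm_num) H
  have h3 := powerSeriesSection_pow_mul_derivative (p := 5) (j := 3) (by norm_num) H
  have h4 := powerSeriesSection_pow_pred_mul_derivative (p := 5) H
  norm_num only at h0 h1 h2 h3 h4
  have hlow (a b c d : ZMod 5) :
      powerSeriesSection 5 4 (evalList H [a, b, c, d] * derivative (ZMod 5) H) = 0 := by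
    have hsplit : evalList H [a, b, c, d] * derivative (ZMod 5) H =
        C a * (H ^ 0 * derivative (ZMod 5) H) + C b * (H ^ 1 * derivative (ZMod 5) H) +
        C c * (H ^ 2 * derivative (ZMod 5) H) + C d * (H ^ 3 * derivative (ZMod 5) H) := by
      simp only [evalList]; ring
    rw [hsplit]
    simp only [map_add, hC, h0, h1, h2, h3, mul_zero, add_zero]
  induction l using everyFifth.induct with
  | case1 a b c d e l ih =>
    have hsplit : evalList H (a :: b :: c :: d :: e :: l) * derivative (ZMod 5) H =
        evalList H [a, b, c, d] * derivative (ZMod 5) H +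
        C e * (H ^ 4 * derivative (ZMod 5) H) +
        H ^ 5 * (evalList H l * derivative (ZMod 5) H) := by
      simp only [evalList]; ring
    rw [hsplit]
    rw [map_add, map_add, hlow, hC, h4, powerSeriesSection_pow_mul (p := 5) (r := 4) (by norm_num),
      ih, everyFifth, evalList]
    ring
  | case2 l hl =>
    rcases l with _ | ⟨a, _ | ⟨b, _ | ⟨c, _ | ⟨d, _ | ⟨e, l⟩⟩⟩⟩⟩
    · simp [evalList, everyFifth]
    · simpa [evalList, everyFifth] using hlow a 0 0 0
    · simpa [evalList, everyFifth] using hlow a b 0 0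
    · simpa [evalList, everyFifth] using hlow a b c 0
    · simpa [evalList, everyFifth] using hlow a b c d
    · exact (hl _ _ _ _ _ _ rfl).elim

/-! ### The digit automaton of the inverse of `X + X ^ 2 - X ^ 6` -/

/-- The coefficients of `X + X ^ 2 - X ^ 6`. -/
def basePolynomial : List (ZMod 5) := [0, 1, 1, 0, 0, 0, -1]

/-- Transition on reading the base-`5` digit `r`: if `H` is the inverse of `X + X ^ 2 - X ^ 6`, the
`r`-th section of `A(H) * H'` is `B(H) * H'` with `B = digitStep A r`. Only `r ≤ 4` is meaningful. -/
def digitStep (l : List (ZMod 5)) (r : ℕ) : List (ZMod 5) :=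
  everyFifth (mulList (powList basePolynomial (4 - r)) l)

theorem five_eq_zero_powerSeries : (5 : (ZMod 5)⟦X⟧) = 0 := by
  have h : ((5 : ℕ) : (ZMod 5)⟦X⟧) = 0 := by
    rw [← map_natCast (C (R := ZMod 5)), CharP.cast_eq_zero, map_zero]
  exact_mod_cast h

section automaton

variable {H : (ZMod 5)⟦X⟧}

theorem evalList_basePolynomial (hH : H + H ^ 2 - H ^ 6 = X) : evalList H basePolynomial = X := by
  rw [← hH]; simp [evalList, basePolynomial]; ring

theorem coeff_evalList_mul_derivative (hH : H + H ^ 2 - H ^ 6 = X) (l : List (ZMod 5))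
    {r : ℕ} (hr : r < 5) (n : ℕ) :
    coeff (r + 5 * n) (evalList H l * derivative (ZMod 5) H) =
      coeff n (evalList H (digitStep l r) * derivative (ZMod 5) H) := by
  -- the `r`-th section of a series is the top section of its product with `X ^ (4 - r)`, and `X` is
  -- the value of `basePolynomial` at `H`
  rw [digitStep, ← powerSeriesSection_evalList_mul_derivative, coeff_powerSeriesSection,
    evalList_mulList, evalList_powList, evalList_basePolynomial hH, mul_assoc,
    show 5 * n + 4 = r + 5 * n + (4 - r) by omega, coeff_X_pow_mul]

theorem derivative_mul_eq_one (hH : H + H ^ 2 - H ^ 6 = X) :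
    (1 + 2 * H - H ^ 5) * derivative (ZMod 5) H = 1 := by
  have h := congrArg (derivative (ZMod 5)) hH
  simp only [map_add, map_sub, derivative_pow, derivative_X] at h
  push_cast at h
  linear_combination h + H ^ 5 * derivative (ZMod 5) H * five_eq_zero_powerSeries

/-- Running the automaton on the base-`5` digits of `n`, least significant first, computes the `n`-th
coefficient of `A(H) * H'` as the constant term of the final state. Leading zeros are allowed. -/
theorem coeff_ofDigits_evalList (hH : H + H ^ 2 - H ^ 6 = X) (h0 : constantCoeff H = 0)
    (l : List (ZMod 5)) (w : List ℕ) (hw : ∀ r ∈ w, r < 5) :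
    coeff (Nat.ofDigits 5 w) (evalList H l * derivative (ZMod 5) H) =
      (w.foldl digitStep l).headD 0 := by
  induction w generalizing l with
  | nil =>
    have h := congrArg constantCoeff (derivative_mul_eq_one hH)
    simp [h0] at h
    simp [constantCoeff_evalList H h0, h]
  | cons r w ih =>
    rw [Nat.ofDigits_cons, coeff_evalList_mul_derivative hH _ (hw r (by simp)),
      ih _ fun s hs => hw s (by simp [hs]), List.foldl_cons]

/-- The coefficients of `X * (1 + 2 * X - X ^ 5)`, the polynomial `A` with `H = A(H) * H'`. -/
def startPolynomial : List (ZMod 5) := [0, 1, 2, 0, 0, 0, -1]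

theorem eq_evalList_startPolynomial (hH : H + H ^ 2 - H ^ 6 = X) :
    H = evalList H startPolynomial * derivative (ZMod 5) H := by
  conv_lhs => rw [← mul_one H, ← derivative_mul_eq_one hH]
  have h2 : C (2 : ZMod 5) = 2 := map_ofNat C 2
  simp [evalList, startPolynomial, h2]; ring

end automaton

/-! ### The algebraic equation of the inverse series -/

theorem thueMorse_add_mul {p : ℕ} (hp : 1 < p) {r : ℕ} (hr : r < p) (n : ℕ) :
    thueMorse p (r + p * n) = r + thueMorse p n := by
  rcases Nat.eq_zero_or_pos r with rfl | h0
  · rcases Nat.eq_zero_or_pos n with rfl | hn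
    · simp
    · rw [thueMorse, thueMorse, Nat.digits_add p hp 0 n hr (Or.inr hn.ne')]; simp
  · rw [thueMorse, thueMorse, Nat.digits_add p hp r n hr (Or.inl h0.ne')]; simp

/-- The digit recursion `t_{5n+r} = t_n + r` for the generating series, with the denominator
`1 - X ^ 5 = (1 - X) ^ 5` cleared. -/
theorem thueMorseSeries_five_equation :
    (1 - X) ^ 2 * thueMorseSeries 5 = (1 - X) ^ 6 * thueMorseSeries 5 ^ 5 + X := by
  have : Fact (Nat.Prime 5) := ⟨Nat.prime_five⟩
  have hcoeff (j r : ℕ) (hj : j < 5) (hr : r < 5) (n : ℕ) (f : (ZMod 5)⟦X⟧) :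
      coeff (r + 5 * n) (X ^ j * f ^ 5) = if r = j then coeff n f else 0 := by
    rw [← expand_eq_pow_of_zmod 5, coeff_X_pow_mul', coeff_expand]
    split_ifs <;> first | omega | skip
    all_goals first | (congr 2; omega) | rfl
  have hgeom : (1 - X ^ 5) * (PowerSeries.mk 1 : (ZMod 5)⟦X⟧) ^ 5 = 1 := by
    have h := congrArg (expand 5 (by norm_num)) (mk_one_mul_one_sub_eq_one (ZMod 5))
    rw [map_mul, map_sub, map_one, expand_X, expand_eq_pow_of_zmod] at h
    rw [mul_comm, h]
  have hrec : thueMorseSeries 5 =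
      (X ^ 0 * thueMorseSeries 5 ^ 5 + X ^ 1 * thueMorseSeries 5 ^ 5 +
        X ^ 2 * thueMorseSeries 5 ^ 5 + X ^ 3 * thueMorseSeries 5 ^ 5 +
        X ^ 4 * thueMorseSeries 5 ^ 5) +
      (C 1 * (X ^ 1 * PowerSeries.mk 1 ^ 5) + C 2 * (X ^ 2 * PowerSeries.mk 1 ^ 5) +
        C 3 * (X ^ 3 * PowerSeries.mk 1 ^ 5) + C 4 * (X ^ 4 * PowerSeries.mk 1 ^ 5)) := by
    ext m
    obtain ⟨n, r, hr, rfl⟩ : ∃ n r, r < 5 ∧ m = r + 5 * n :=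
      ⟨m / 5, m % 5, Nat.mod_lt _ (by norm_num), (Nat.mod_add_div m 5).symm⟩
    simp only [map_add, coeff_C_mul, hcoeff _ r (show 0 < 5 by norm_num) hr,
      hcoeff _ r (show 1 < 5 by norm_num) hr, hcoeff _ r (show 2 < 5 by norm_num) hr,
      hcoeff _ r (show 3 < 5 by norm_num) hr, hcoeff _ r (show 4 < 5 by norm_num) hr]
    simp only [thueMorseSeries, coeff_mk, thueMorse_add_mul (show 1 < 5 by norm_num) hr]
    interval_cases r <;> simp [add_comm]
  have hne : (1 - X : (ZMod 5)⟦X⟧) ^ 3 ≠ 0 := by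
    refine pow_ne_zero _ fun h => ?_
    have := congrArg constantCoeff h
    simp at this
  have h2 : C (2 : ZMod 5) = 2 := map_ofNat C 2
  have h3 : C (3 : ZMod 5) = 3 := map_ofNat C 3
  have h4 : C (4 : ZMod 5) = 4 := map_ofNat C 4
  rw [map_one, h2, h3, h4] at hrec
  refine mul_left_cancel₀ hne ?_
  generalize (PowerSeries.mk 1 : (ZMod 5)⟦X⟧) ^ 5 = E at hgeom hrec
  generalize thueMorseSeries 5 = F at hrec ⊢
  -- the two multiples of `5` are `(1 - X) ^ 5 * (1 + X + X ^ 2 + X ^ 3 + X ^ 4) - (1 - X) ^ 9` and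
  -- `(1 - X) ^ 5 * (X + 2 * X ^ 2 + 3 * X ^ 3 + 4 * X ^ 4) - X * (1 - X) ^ 3 * (1 - X ^ 5)`
  linear_combination (1 - X) ^ 5 * hrec + X * (1 - X) ^ 3 * hgeom +
    (F ^ 5 * (X - 6 * X ^ 2 + 16 * X ^ 3 - 25 * X ^ 4 + 25 * X ^ 5 - 16 * X ^ 6 + 6 * X ^ 7 - X ^ 8) +
      E * (-X ^ 5 + 4 * X ^ 6 - 6 * X ^ 7 + 4 * X ^ 8 - X ^ 9)) * five_eq_zero_powerSeries

/-- `X * (1 - C_5)`, the compositional inverse of `X + X ^ 2 - X ^ 6`. -/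
noncomputable def shiftedInverse : (ZMod 5)⟦X⟧ := X * (1 - inverseSeries 5)

theorem constantCoeff_shiftedInverse : constantCoeff shiftedInverse = 0 := by
  simp [shiftedInverse]

/-- Substituting `C = C_5` for `X` in the equation of `F_5` gives
`(1 - C) ^ 2 * X = (1 - C) ^ 6 * X ^ 5 + C`; multiplication by `X` turns it into an equation in
`X * (1 - C)`. -/
theorem shiftedInverse_equation :
    shiftedInverse + shiftedInverse ^ 2 - shiftedInverse ^ 6 = X := by
  obtain ⟨h0, h1, -⟩ := inverseSeries_spec 5
  have hs : HasSubst (inverseSeries 5) := HasSubst.of_constantCoeff_zero' h0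
  have h := congrArg (substAlgHom (R := ZMod 5) hs) thueMorseSeries_five_equation
  simp only [map_mul, map_add, map_pow, map_sub, map_one, substAlgHom_X] at h
  rw [coe_substAlgHom, h1] at h
  rw [shiftedInverse]
  linear_combination X * h

theorem d_eq_neg_coeff {n : ℕ} (hn : n ≠ 0) : d n = -coeff (n + 1) shiftedInverse := by
  rw [shiftedInverse, coeff_succ_X_mul, map_sub, coeff_one, if_neg hn]
  simp [d, inverseThueMorse]

/-- `d_n` is computed by running the digit automaton on the base-`5` digits of `n + 1`. -/
theorem d_eq_of_ofDigits {n : ℕ} (hn : n ≠ 0) {w : List ℕ} (hw : ∀ r ∈ w, r < 5)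
    (h : n + 1 = Nat.ofDigits 5 w) : d n = -(w.foldl digitStep startPolynomial).headD 0 := by
  rw [d_eq_neg_coeff hn, h,
    ← coeff_ofDigits_evalList shiftedInverse_equation constantCoeff_shiftedInverse _ _ hw,
    ← eq_evalList_startPolynomial shiftedInverse_equation]

/-- The index `5 * n + 3` of `d` corresponds to the index `5 * n + 4` of `shiftedInverse`, and the
digit `4` leads from the initial state to the zero polynomial. -/
theorem d_five_mul_add_three (n : ℕ) : d (5 * n + 3) = 0 := by
  rw [d_eq_neg_coeff (by omega),
    eq_evalList_startPolynomial shiftedInverse_equation, show 5 * n + 3 + 1 = 4 + 5 * n by ring,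
    coeff_evalList_mul_derivative shiftedInverse_equation _ (by norm_num),
    show digitStep startPolynomial 4 = [0] by decide]
  simp [evalList]

/-! ### Runs of equal terms -/

/-- The states `[1 + c, c]` form the set in which the automaton stays while it reads the digits
`2`. -/
theorem digitStep_two (c : ZMod 5) : digitStep [1 + c, c] 2 = [1 + 3 * c, 3 * c] := by
  revert c; decide

theorem foldl_digitStep_replicate_two (n : ℕ) (c : ZMod 5) :
    ∃ c', (List.replicate n 2).foldl digitStep [1 + c, c] = [1 + c', c'] := by
  induction n generalizing c with
  | zero => exact ⟨c, rfl⟩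
  | succ n ih => rw [List.replicate_succ, List.foldl_cons, digitStep_two]; exact ih _

theorem foldl_digitStep_prefix {j : ℕ} (hj : j < 4) :
    ∃ c, [j, 0, 3].foldl digitStep startPolynomial = [1 + c, c] := by
  revert j; decide

/-- From every state `[1 + c, c]` the leading digits produce the same value, independent of `c`;
hence the number of digits `2` read before does not matter. -/
theorem foldl_digitStep_leadingDigits {i : ℕ} (h1 : 1 ≤ i) (h4 : i ≤ 4) (c : ZMod 5) :
    ((leadingDigits i).reverse.foldl digitStep [1 + c, c]).headD 0 = -(i : ZMod 5) := by
  revert c; interval_cases i <;> decide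

theorem explicitStart_eq (i n : ℕ) : explicitStart i n =
    24 + 25 * Nat.ofDigits 5 (List.replicate (n + 1) 2 ++ (leadingDigits i).reverse) := by
  simp only [explicitStart, List.reverse_append, List.reverse_replicate]
  simp [Nat.ofDigits_cons]
  ring

theorem explicitStart_mem_fourRunStarts {i : ℕ} (h1 : 1 ≤ i) (h4 : i ≤ 4) (n : ℕ) :
    explicitStart i n ∈ fourRunStarts i := by
  have hlead : ∀ r ∈ leadingDigits i, r < 5 := by interval_cases i <;> decide
  have key (j : ℕ) (hj : j < 4) : d (explicitStart i n + j) = (i : ZMod 5) := by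
    rw [d_eq_of_ofDigits (w := [j, 0, 3] ++ (List.replicate n 2 ++ (leadingDigits i).reverse))]
    · obtain ⟨c, hc⟩ := foldl_digitStep_prefix hj
      obtain ⟨c', hc'⟩ := foldl_digitStep_replicate_two n c
      rw [List.foldl_append, List.foldl_append, hc, hc', foldl_digitStep_leadingDigits h1 h4,
        neg_neg]
    · rw [explicitStart_eq]; omega
    · intro r hr
      simp only [List.mem_append, List.mem_cons, List.not_mem_nil, or_false, List.mem_replicate,
        List.mem_reverse] at hr
      rcases hr with (rfl | rfl | rfl) | ⟨-, rfl⟩ | hr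
      · omega
      · norm_num
      · norm_num
      · norm_num
      · exact hlead r hr
    · -- adding `1 + j` to the final digits `2, 4, 4` carries to `3, 0, j`
      rw [explicitStart_eq, List.replicate_succ, List.cons_append, List.cons_append,
        List.cons_append, List.cons_append, List.nil_append]
      simp only [Nat.ofDigits_cons]
      ring
  exact ⟨key 0 (by norm_num), key 1 (by norm_num), key 2 (by norm_num), key 3 (by norm_num)⟩

theorem lt_explicitStart (i n : ℕ) : n < explicitStart i n := by
  rw [explicitStart_eq]
  suffices h : ∀ w : List ℕ, n < Nat.ofDigits 5 (List.replicate (n + 1) 2 ++ w) by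
    have := h (leadingDigits i).reverse
    omega
  intro w
  induction n with
  | zero => rw [List.replicate_succ, List.cons_append, Nat.ofDigits_cons]; omega
  | succ n ih => rw [List.replicate_succ, List.cons_append, Nat.ofDigits_cons]; omega

theorem infinite_fourRunStarts {i : ℕ} (h1 : 1 ≤ i) (h4 : i ≤ 4) : (fourRunStarts i).Infinite :=
  Set.infinite_of_forall_exists_gt fun n =>
    ⟨_, explicitStart_mem_fourRunStarts h1 h4 n, lt_explicitStart i n⟩

/-- Five consecutive indices include one congruent to `3` modulo `5`, where `d` vanishes. -/
theorem length_run_le_four {i : ℕ} (h1 : 1 ≤ i) (h4 : i ≤ 4) {n L : ℕ}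
    (h : ∀ j < L, d (n + j) = (i : ZMod 5)) : L ≤ 4 := by
  by_contra! hL
  obtain ⟨j, m, hj, hm⟩ : ∃ j m, j < 5 ∧ n + j = 5 * m + 3 :=
    ⟨(8 - n % 5) % 5, (n + (8 - n % 5) % 5) / 5, by omega, by omega⟩
  have hd := h j (by omega)
  rw [hm, d_five_mul_add_three, eq_comm, ZMod.natCast_eq_zero_iff] at hd
  exact absurd (Nat.le_of_dvd (by omega) hd) (by omega)

theorem mainTheorem6 :
    (∀ n : ℕ, d (5 * n + 3) = 0) ∧
    ∀ i : ℕ, 1 ≤ i → i ≤ 4 →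
      IsGreatest {L : ℕ | ∃ n : ℕ, ∀ j < L, d (n + j) = (i : ZMod 5)} 4 ∧
      (fourRunStarts i).Infinite ∧
      ∀ n : ℕ, explicitStart i n ∈ fourRunStarts i := by
  refine ⟨d_five_mul_add_three, fun i h1 h4 =>
    ⟨⟨⟨explicitStart i 0, fun j hj => ?_⟩, fun L ⟨n, hn⟩ => length_run_le_four h1 h4 hn⟩,
      infinite_fourRunStarts h1 h4, explicitStart_mem_fourRunStarts h1 h4⟩⟩
  obtain ⟨h0, h1, h2, h3⟩ := explicitStart_mem_fourRunStarts h1 h4 0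
  interval_cases j <;> assumption
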